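/- Let $\alpha>0$, $\sigma_R>0$, $P_S>0$, and consider the source–relay link $Y_R=X_S+I+N_R$, where, given $X_R=x_R$, the source input $X_S$, the residual self-interference $I\sim\mathcal N(0,\alpha x_R^2)$ and the noise $N_R\sim\mathcal N(0,\sigma_R^2)$ are independent. Fix any distribution $p(x_R)$ of the real-valued relay input $X_R$ (discrete, continuous, or an arbitrary Borel probability measure). There is exactly one $x_{\rm th}>0$ with $$E\big[\alpha\max\{0,x_{\rm th}^2-X_R^2\}\big]=P_S .$$ Over all conditional distributions $p(x_S|x_R)$ with $E[X_S^2]\le P_S$, the conditional mutual information $I(X_S;Y_R|X_R)$ (the average over $p(x_R)$ of $I(X_S;Y_R|X_R=x_R)$, in bits) attains its maximum, and the optimal input distribution $p^*(x_S|x_R)$, which is unique up to a set of values $x_R$ of probability zero, is the zero-mean Gaussian distribution with variance $$P_S(x_R)=\alpha\max\{0,x_{\rm th}^2-x_R^2\}$$ (the point mass at $0$ where this variance is $0$). The maximum is finite and equals $$\max_{p(x_S|x_R)} I(X_S;Y_R|X_R)=E\left[\frac12\log_2\left(1+\frac{\alpha\max\{0,x_{\rm th}^2-X_R^2\}}{\sigma_R^2+\alpha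 X_R^2}\right)\right].$$ Here $E$ denotes expectation under $p(x_R)$, in the two displayed formulas for the threshold and for the maximum: a sum $\sum_{x_R}(\cdot)\,p(x_R)$ if $p(x_R)$ is discrete and an integral if it is continuous. -/

import Mathlib

open MeasureTheory ProbabilityTheory
open scoped ENNReal NNReal

noncomputable section

namespace RelayChannel

/-- Mutual information, in bits, of a pair of random variables with joint law `ρ`: the
Kullback-Leibler divergence of the joint law from the product of its marginals. -/
def mutualInfo {A B : Type*} [MeasurableSpace A] [MeasurableSpace B] (ρ : Measure (A × B)) :
    ℝ≥0∞ :=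
  InformationTheory.klDiv ρ (ρ.fst.prod ρ.snd) / ENNReal.ofReal (Real.log 2)

/-- The joint law of `(X_S, Y_R)` given `X_R = x`, where `Y_R = X_S + I + N_R`, when `X_S` has
conditional law `ν`, the residual self-interference is `I ∼ N(0, α x²)`, the relay noise is
`N_R ∼ N(0, σR²)`, and `X_S`, `I`, `N_R` are independent (given `X_R = x`). -/
def sourceRelayLaw (α σR x : ℝ) (ν : Measure ℝ) : Measure (ℝ × ℝ) :=
  ((ν.prod (gaussianReal 0 (α * x ^ 2).toNNReal)).prod (gaussianReal 0 (σR ^ 2).toNNReal)).map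
    (fun w => (w.1.1, w.1.1 + w.1.2 + w.2))

/-- Conditional mutual information `I(X_S; Y_R | X_R)`, in bits, when `X_R` has law `μ` and
`X_S` has conditional law `κ x` given `X_R = x`: the average over `μ` of `I(X_S; Y_R | X_R = x)`. -/
def condMutualInfo (α σR : ℝ) (μ : Measure ℝ) (κ : Kernel ℝ ℝ) : ℝ≥0∞ :=
  ∫⁻ x, mutualInfo (sourceRelayLaw α σR x (κ x)) ∂μ

/-- The average source power `E[X_S²]`. -/
def sourcePower (μ : Measure ℝ) (κ : Kernel ℝ ℝ) : ℝ≥0∞ :=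
  ∫⁻ x, ∫⁻ s, ENNReal.ofReal (s ^ 2) ∂(κ x) ∂μ

/-- The admissible conditional source input distributions `p(x_S | x_R)`: all probability
kernels which meet the average power constraint `E[X_S²] ≤ P`. -/
def admissible (μ : Measure ℝ) (P : ℝ) : Set (Kernel ℝ ℝ) :=
  {κ | IsMarkovKernel κ ∧ sourcePower μ κ ≤ ENNReal.ofReal P}

/-- The power allocation `α max {0, t² - x²}` with threshold `t`. -/
def powerAlloc (α t x : ℝ) : ℝ := α * max 0 (t ^ 2 - x ^ 2)

lemma measurable_powerAlloc (α t : ℝ) : Measurable (powerAlloc α t) := by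
  unfold powerAlloc
  fun_prop

/-- The conditional source input which, given `X_R = x`, is zero-mean Gaussian with variance
`α max {0, t² - x²}` (the point mass at `0` where this variance vanishes). -/
def gaussianSource (α t : ℝ) : Kernel ℝ ℝ where
  toFun x := gaussianReal 0 (powerAlloc α t x).toNNReal
  measurable' := by
    have h : Measurable (fun x : ℝ => ((0 : ℝ), (powerAlloc α t x).toNNReal)) :=
      measurable_const.prodMk (measurable_powerAlloc α t).real_toNNReal
    exact measurable_gaussianReal.comp h

end RelayChannel

end

/-!
Let `v = σR² + α x²` be the noise variance at relay input `x`, `P` the allocated power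
`α max {0, t² - x²}` and `b = v + P` the resulting output variance. For any input law `ν` with
output law `Q = ν ∗ N(0, v)`, the mutual information (in nats) satisfies the identity
`I(ν) + D(Q ‖ N(0, b)) = ½ log (b / v) + (E[S²] - P) / (2 b)` (`klDiv_awgn_add`). Indeed, by the
chain rule for the divergence the left side is the divergence of the joint law from
`ν × N(0, b)` (`klDiv_prod_fst_eq_add`), which is also the average over `ν` of the explicit
divergences `D(N(s, v) ‖ N(0, b))` (`klDiv_compProd_right`, `klDiv_gaussianReal`).

Since `b = σR² + α max {x², t²}`, the factor `1 / (2 b)` is at most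
`λ = 1 / (2 (σR² + α t²))`, with equality where `P > 0`. Hence
`I(ν) + D(Q ‖ N(0, b)) ≤ ½ log (b / v) + λ (E[S²] - P)` (`mutualInfoNats_add_outputGap_le`), and
averaging over the relay input, the last term is at most zero by the power constraint and the
choice of `t` (`lintegral_mutualInfoNats_add_outputGap_le`). The Gaussian input attains the bound
because its output law is `N(0, b)`. Conversely, a maximizer must have `D(Q ‖ N(0, b)) = 0` for
almost every `x`, so that `ν ∗ N(0, v) = N(0, P) ∗ N(0, v)`, and cancelling the noise on
characteristic functions gives `ν = N(0, P)`.

The threshold exists because the total power is continuous in `t`, vanishes at `0` and tends to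
infinity, and it is unique because the total power is strictly increasing where it is positive
(`existsUnique_threshold`).
-/

namespace RelayChannel

open InformationTheory

/-! ### Identities for the Kullback-Leibler divergence -/

section KullbackLeibler

variable {A B : Type*} [MeasurableSpace A] [MeasurableSpace B]

lemma klDiv_map_measurableEquiv (e : A ≃ᵐ B) (ρ τ : Measure A)
    [IsFiniteMeasure ρ] [IsFiniteMeasure τ] :
    klDiv (ρ.map e) (τ.map e) = klDiv ρ τ := by
  refine le_antisymm (klDiv_map_le ρ τ e.measurable) ?_
  simpa using klDiv_map_le (ρ.map e) (τ.map e) e.symm.measurable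

/-- The chain rule in integral form: for two joint laws with the same first marginal, the
divergence is the average of the divergences of the conditional laws. -/
lemma klDiv_compProd_right [MeasurableSpace.CountableOrCountablyGenerated A B]
    (ν : Measure A) [IsProbabilityMeasure ν] (κ η : Kernel A B) [IsMarkovKernel κ]
    [IsMarkovKernel η] (hac : ∀ a, κ a ≪ η a) :
    klDiv (ν ⊗ₘ κ) (ν ⊗ₘ η) = ∫⁻ a, klDiv (κ a) (η a) ∂ν := by
  have hκ : η.withDensity (κ.rnDeriv η) = κ := by
    ext1 a
    exact Kernel.withDensity_rnDeriv_eq (hac a)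
  have hdens : ν ⊗ₘ κ = (ν ⊗ₘ η).withDensity (fun p => κ.rnDeriv η p.1 p.2) := by
    have : IsSFiniteKernel (η.withDensity (κ.rnDeriv η)) := by rw [hκ]; infer_instance
    conv_lhs => rw [← hκ]
    rw [Measure.compProd_withDensity (Kernel.measurable_rnDeriv κ η)]
  have hrn : (ν ⊗ₘ κ).rnDeriv (ν ⊗ₘ η) =ᵐ[ν ⊗ₘ η] fun p => κ.rnDeriv η p.1 p.2 := by
    rw [hdens]
    exact Measure.rnDeriv_withDensity _ (Kernel.measurable_rnDeriv κ η)
  rw [klDiv_eq_lintegral_klFun_of_ac (Measure.AbsolutelyContinuous.compProd_right (.of_forall hac))]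
  calc _ = ∫⁻ p, ENNReal.ofReal (klFun (κ.rnDeriv η p.1 p.2).toReal) ∂(ν ⊗ₘ η) := by
        refine lintegral_congr_ae ?_
        filter_upwards [hrn] with p hp
        rw [hp]
    _ = ∫⁻ a, ∫⁻ y, ENNReal.ofReal (klFun (κ.rnDeriv η a y).toReal) ∂(η a) ∂ν := by
        refine Measure.lintegral_compProd ?_
        exact (measurable_klFun.comp (Kernel.measurable_rnDeriv κ η).ennreal_toReal).ennreal_ofReal
    _ = _ := by
        refine lintegral_congr fun a => ?_
        rw [klDiv_eq_lintegral_klFun_of_ac (hac a)]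
        refine lintegral_congr_ae ?_
        filter_upwards [Kernel.rnDeriv_eq_rnDeriv_measure (κ := κ) (η := η) (a := a)] with y hy
        rw [hy]

/-- The jointly measurable version `Kernel.rnDeriv` of the densities makes the divergence of two
kernels a measurable function of the parameter. -/
lemma measurable_klDiv_kernel [MeasurableSpace.CountableOrCountablyGenerated A B]
    (κ η : Kernel A B) [IsMarkovKernel κ] [IsMarkovKernel η] (hac : ∀ a, κ a ≪ η a) :
    Measurable fun a => klDiv (κ a) (η a) := by
  have h : (fun a => klDiv (κ a) (η a)) =
      fun a => ∫⁻ y, ENNReal.ofReal (klFun (κ.rnDeriv η a y).toReal) ∂(η a) := by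
    funext a
    rw [klDiv_eq_lintegral_klFun_of_ac (hac a)]
    refine lintegral_congr_ae ?_
    filter_upwards [Kernel.rnDeriv_eq_rnDeriv_measure (κ := κ) (η := η) (a := a)] with y hy
    rw [hy]
  rw [h]
  exact Measurable.lintegral_kernel_prod_right
    (measurable_klFun.comp (Kernel.measurable_rnDeriv κ η).ennreal_toReal).ennreal_ofReal

/-- The divergence of a joint law from a product with an arbitrary second factor `G` is the mutual
information plus the divergence of the second marginal from `G`. This is the chain rule applied
after exchanging the two coordinates. -/
lemma klDiv_prod_fst_eq_add [StandardBorelSpace A] [Nonempty A]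
    (ρ : Measure (A × B)) [IsProbabilityMeasure ρ] (G : Measure B) [IsProbabilityMeasure G] :
    klDiv ρ (ρ.fst.prod G) = klDiv ρ.snd G + klDiv ρ (ρ.fst.prod ρ.snd) := by
  have hswap : ρ.map MeasurableEquiv.prodComm = ρ.snd ⊗ₘ (ρ.map Prod.swap).condKernel := by
    rw [← Measure.fst_map_swap, Measure.disintegrate]
    rfl
  have hprod : ∀ G : Measure B, IsProbabilityMeasure G →
      (ρ.fst.prod G).map MeasurableEquiv.prodComm = G ⊗ₘ Kernel.const B ρ.fst := by
    intro G _
    rw [Measure.compProd_const]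
    exact Measure.prod_swap
  rw [← klDiv_map_measurableEquiv MeasurableEquiv.prodComm ρ (ρ.fst.prod G),
    ← klDiv_map_measurableEquiv MeasurableEquiv.prodComm ρ (ρ.fst.prod ρ.snd),
    hprod G inferInstance, hprod ρ.snd inferInstance, hswap, klDiv_compProd_eq_add]

end KullbackLeibler

/-! ### Gaussian measures on the line -/

section Gaussian

lemma integral_sub_sq_gaussianReal (m m' : ℝ) (v : ℝ≥0) :
    Integrable (fun y => (y - m') ^ 2) (gaussianReal m v) ∧
      ∫ y, (y - m') ^ 2 ∂(gaussianReal m v) = v + (m - m') ^ 2 := by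
  have h2 : MemLp (fun y : ℝ => y - m') 2 (gaussianReal m v) :=
    (memLp_id_gaussianReal 2).sub (memLp_const m')
  refine ⟨h2.integrable_sq, ?_⟩
  have hvar := variance_eq_sub h2
  have hid : Integrable (fun y : ℝ => y) (gaussianReal m v) :=
    (memLp_id_gaussianReal 1).integrable le_rfl
  rw [variance_sub_const (by fun_prop), variance_fun_id_gaussianReal,
    integral_sub hid (integrable_const _)] at hvar
  simp only [integral_id_gaussianReal, integral_const, probReal_univ, smul_eq_mul, one_mul,
    Pi.pow_apply] at hvar
  linarith

lemma lintegral_sq_gaussianReal (v : ℝ≥0) :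
    ∫⁻ y, ENNReal.ofReal (y ^ 2) ∂(gaussianReal 0 v) = v := by
  obtain ⟨hi, he⟩ := integral_sub_sq_gaussianReal 0 0 v
  simp only [sub_zero, ne_eq, OfNat.ofNat_ne_zero, not_false_eq_true, zero_pow, add_zero]
    at hi he
  rw [← ofReal_integral_eq_lintegral_ofReal hi (.of_forall fun y => sq_nonneg y), he,
    ENNReal.ofReal_coe_nnreal]

lemma gaussianReal_absolutelyContinuous_gaussianReal (m m' : ℝ) {v b : ℝ≥0}
    (hv : v ≠ 0) (hb : b ≠ 0) : gaussianReal m v ≪ gaussianReal m' b :=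
  (gaussianReal_absolutelyContinuous m hv).trans (gaussianReal_absolutelyContinuous' m' hb)

lemma llr_gaussianReal (m m' : ℝ) {v b : ℝ≥0} (hv : v ≠ 0) (hb : b ≠ 0) :
    llr (gaussianReal m v) (gaussianReal m' b) =ᵐ[gaussianReal m v] fun y =>
      1 / 2 * Real.log (b / v) - (y - m) ^ 2 / (2 * v) + (y - m') ^ 2 / (2 * b) := by
  have hdens : gaussianReal m v =
      (gaussianReal m' b).withDensity (fun y => gaussianPDF m v y / gaussianPDF m' b y) := by
    rw [gaussianReal_of_var_ne_zero m hv, gaussianReal_of_var_ne_zero m' hb,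
      ← withDensity_mul _ (by fun_prop) (by fun_prop)]
    congr 1
    funext y
    exact (ENNReal.mul_div_cancel (gaussianPDF_pos m' hb y).ne' gaussianPDF_ne_top).symm
  have hrn : (gaussianReal m v).rnDeriv (gaussianReal m' b) =ᵐ[gaussianReal m' b]
      fun y => gaussianPDF m v y / gaussianPDF m' b y := by
    conv_lhs => rw [hdens]
    exact Measure.rnDeriv_withDensity _ (by fun_prop)
  filter_upwards [(gaussianReal_absolutelyContinuous_gaussianReal m m' hv hb).ae_eq hrn] with y hy
  have hv' : (0 : ℝ) < v := by positivity
  have hb' : (0 : ℝ) < b := by positivity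
  rw [llr, hy, ENNReal.toReal_div, toReal_gaussianPDF, toReal_gaussianPDF,
    Real.log_div (gaussianPDFReal_pos m v y hv).ne' (gaussianPDFReal_pos m' b y hb).ne',
    gaussianPDFReal, gaussianPDFReal,
    Real.log_mul (by positivity) (Real.exp_pos _).ne',
    Real.log_mul (by positivity) (Real.exp_pos _).ne', Real.log_exp, Real.log_exp,
    Real.log_inv, Real.log_inv, Real.log_sqrt (by positivity), Real.log_sqrt (by positivity),
    Real.log_mul (by positivity) hv'.ne', Real.log_mul (by positivity) hb'.ne',
    Real.log_div hb'.ne' hv'.ne']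
  ring

lemma klDiv_gaussianReal (m m' : ℝ) {v b : ℝ≥0} (hv : v ≠ 0) (hb : b ≠ 0) :
    klDiv (gaussianReal m v) (gaussianReal m' b) = ENNReal.ofReal
      (1 / 2 * Real.log (b / v) - 1 / 2 + (v + (m - m') ^ 2) / (2 * b)) := by
  have hllr := llr_gaussianReal m m' hv hb
  obtain ⟨hi, he⟩ := integral_sub_sq_gaussianReal m m v
  obtain ⟨hi', he'⟩ := integral_sub_sq_gaussianReal m m' v
  have hsub : Integrable (fun y => 1 / 2 * Real.log (b / v) - (y - m) ^ 2 / (2 * v))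
      (gaussianReal m v) := (integrable_const _).sub (hi.div_const (2 * v))
  have hint := hsub.add (hi'.div_const (2 * b))
  rw [klDiv_of_ac_of_integrable (gaussianReal_absolutelyContinuous_gaussianReal m m' hv hb)
    ((integrable_congr hllr).2 hint), integral_congr_ae hllr,
    integral_add hsub (hi'.div_const (2 * b)),
    integral_sub (integrable_const _) (hi.div_const (2 * v)), integral_div, integral_div, he, he']
  have hv' : (v : ℝ) ≠ 0 := by exact_mod_cast hv
  congr 1
  simp only [integral_const, probReal_univ, smul_eq_mul, one_mul, sub_self]
  field_simp
  ring

/-- Gaussian noise can be deconvolved, since its characteristic function has no zeros. -/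
lemma conv_gaussianReal_right_injective {ν τ : Measure ℝ} [IsFiniteMeasure ν] [IsFiniteMeasure τ]
    (m : ℝ) (v : ℝ≥0) (h : ν ∗ gaussianReal m v = τ ∗ gaussianReal m v) : ν = τ := by
  refine Measure.ext_of_charFun (funext fun s => ?_)
  have hs := congrArg (fun ρ => charFun ρ s) h
  simp only [charFun_conv, charFun_gaussianReal] at hs
  exact mul_right_cancel₀ (Complex.exp_ne_zero _) hs

end Gaussian

/-! ### The additive Gaussian noise channel -/

section Channel

/-- The additive Gaussian noise channel: the output given the input `s` is `N(s, v)`. -/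
noncomputable def awgn (v : ℝ≥0) : Kernel ℝ ℝ where
  toFun s := gaussianReal s v
  measurable' := measurable_gaussianReal.comp (measurable_id.prodMk measurable_const)

lemma awgn_apply (v : ℝ≥0) (s : ℝ) : awgn v s = gaussianReal s v := rfl

instance (v : ℝ≥0) : IsMarkovKernel (awgn v) := ⟨fun s => by rw [awgn_apply]; infer_instance⟩

lemma lintegral_awgn (v : ℝ≥0) (s : ℝ) {f : ℝ → ℝ≥0∞} (hf : Measurable f) :
    ∫⁻ y, f y ∂(awgn v s) = ∫⁻ z, f (s + z) ∂(gaussianReal 0 v) := by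
  have h : awgn v s = (gaussianReal 0 v).map (s + ·) := by
    rw [gaussianReal_map_const_add, zero_add, awgn_apply]
  rw [h, lintegral_map hf (by fun_prop)]

lemma snd_compProd_awgn (ν : Measure ℝ) [IsProbabilityMeasure ν] (v : ℝ≥0) :
    (ν ⊗ₘ awgn v).snd = ν ∗ gaussianReal 0 v := by
  refine Measure.ext_of_lintegral _ fun f hf => ?_
  rw [Measure.snd, lintegral_map hf measurable_snd, Measure.lintegral_compProd (by fun_prop),
    Measure.lintegral_conv hf]
  exact lintegral_congr fun s => lintegral_awgn v s hf

/-- The self-interference and the receiver noise add up to a single Gaussian noise. -/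
lemma sourceRelayLaw_eq_compProd (α σR x : ℝ) (ν : Measure ℝ) [IsProbabilityMeasure ν] :
    sourceRelayLaw α σR x ν =
      ν ⊗ₘ awgn ((α * x ^ 2).toNNReal + (σR ^ 2).toNNReal) := by
  refine Measure.ext_of_lintegral _ fun f hf => ?_
  rw [sourceRelayLaw, lintegral_map hf (by fun_prop), lintegral_prod _ (by fun_prop),
    lintegral_prod _ (by fun_prop), Measure.lintegral_compProd hf]
  refine lintegral_congr fun s => ?_
  rw [lintegral_awgn _ _ (by fun_prop), ← add_zero (0 : ℝ), ← gaussianReal_conv_gaussianReal,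
    Measure.lintegral_conv (by fun_prop)]
  simp only [add_zero, add_assoc]

/-- The mutual information of the channel plus the divergence of its output law from `N(0, b)`
depends on the input law only through its second moment: the sum is
`½ log (b / v) + (E[S²] - (b - v)) / (2 b)`. The negative term is moved to the left because the
identity is stated in `ℝ≥0∞`; it also holds when the second moment is infinite. -/
lemma klDiv_awgn_add (ν : Measure ℝ) [IsProbabilityMeasure ν] {v b : ℝ≥0} (hv : v ≠ 0)
    (hvb : v ≤ b) :
    klDiv (ν ⊗ₘ awgn v) ((ν ⊗ₘ awgn v).fst.prod (ν ⊗ₘ awgn v).snd) +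
        klDiv (ν ∗ gaussianReal 0 v) (gaussianReal 0 b) + ENNReal.ofReal ((b - v) / (2 * b)) =
      ENNReal.ofReal (1 / 2 * Real.log (b / v)) +
        ENNReal.ofReal (1 / (2 * b)) * ∫⁻ s, ENNReal.ofReal (s ^ 2) ∂ν := by
  have hv0 : (0 : ℝ) < v := by positivity
  have hb : b ≠ 0 := (hv.bot_lt.trans_le hvb).ne'
  have hb0 : (0 : ℝ) < b := by positivity
  have hvb' : (v : ℝ) ≤ b := by exact_mod_cast hvb
  have hlog : 0 ≤ Real.log (b / v) := Real.log_nonneg ((one_le_div hv0).2 hvb')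
  have hgap : 0 ≤ ((b : ℝ) - v) / (2 * b) := div_nonneg (by linarith) (by linarith)
  have hkl : klDiv (ν ⊗ₘ awgn v) ((ν ⊗ₘ awgn v).fst.prod (gaussianReal 0 b)) =
      ∫⁻ s, klDiv (gaussianReal s v) (gaussianReal 0 b) ∂ν := by
    rw [Measure.fst_compProd, ← Measure.compProd_const,
      klDiv_compProd_right ν _ _ fun s => by
        rw [awgn_apply, Kernel.const_apply]
        exact gaussianReal_absolutelyContinuous_gaussianReal s 0 hv hb]
    rfl
  rw [add_comm (klDiv _ _), ← snd_compProd_awgn ν v, ← klDiv_prod_fst_eq_add, hkl]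
  -- the constant is added under the integral, so that every term stays nonnegative
  calc _ = ∫⁻ s, (klDiv (gaussianReal s v) (gaussianReal 0 b) +
          ENNReal.ofReal ((b - v) / (2 * b))) ∂ν := by
        rw [lintegral_add_right _ measurable_const]
        simp
    _ = ∫⁻ s, (ENNReal.ofReal (1 / 2 * Real.log (b / v)) +
          ENNReal.ofReal (1 / (2 * b)) * ENNReal.ofReal (s ^ 2)) ∂ν := by
        refine lintegral_congr fun s => ?_
        rw [klDiv_gaussianReal s 0 hv hb, ← ENNReal.ofReal_mul (by positivity),
          ← ENNReal.ofReal_add (mul_nonneg (by norm_num) hlog) (by positivity),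
          ← ENNReal.ofReal_add _ hgap]
        · congr 1
          field_simp
          ring
        · -- `log (v / b) ≤ v / b - 1`
          have := Real.log_le_sub_one_of_pos (div_pos hv0 hb0)
          rw [← inv_div, Real.log_inv] at this
          have h1 : (v + (s - 0) ^ 2) / (2 * b) = 1 / 2 * ((b : ℝ) / v)⁻¹ + s ^ 2 / (2 * b) := by
            rw [inv_div]
            field_simp
            ring
          have h2 : 0 ≤ s ^ 2 / (2 * (b : ℝ)) := by positivity
          linarith
    _ = _ := by
        rw [lintegral_add_left measurable_const, lintegral_const_mul _ (by fun_prop)]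
        simp

end Channel

/-! ### The threshold of the power allocation -/

section Threshold

variable (μ : Measure ℝ) [IsProbabilityMeasure μ]

lemma powerAlloc_nonneg {α : ℝ} (hα : 0 ≤ α) (t x : ℝ) : 0 ≤ powerAlloc α t x :=
  mul_nonneg hα (le_max_left _ _)

lemma max_zero_sub_sq_le (t x : ℝ) : max 0 (t ^ 2 - x ^ 2) ≤ t ^ 2 :=
  max_le (sq_nonneg t) (by nlinarith [sq_nonneg x])

lemma norm_powerAlloc_le {α : ℝ} (hα : 0 ≤ α) (t x : ℝ) : ‖powerAlloc α t x‖ ≤ α * t ^ 2 := by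
  rw [Real.norm_of_nonneg (powerAlloc_nonneg hα t x)]
  exact mul_le_mul_of_nonneg_left (max_zero_sub_sq_le t x) hα

lemma integrable_powerAlloc {α : ℝ} (hα : 0 ≤ α) (t : ℝ) : Integrable (powerAlloc α t) μ :=
  Integrable.of_bound (measurable_powerAlloc α t).aestronglyMeasurable (α * t ^ 2)
    (.of_forall fun x => norm_powerAlloc_le hα t x)

lemma continuousOn_integral_powerAlloc {α : ℝ} (hα : 0 ≤ α) (T : ℝ) :
    ContinuousOn (fun t => ∫ x, powerAlloc α t x ∂μ) (Set.Icc 0 T) := by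
  refine continuousOn_of_dominated (bound := fun _ => α * T ^ 2)
    (fun t _ => (measurable_powerAlloc α t).aestronglyMeasurable) (fun t ht => ?_)
    (integrable_const _) (.of_forall fun x => ?_)
  · refine .of_forall fun x => (norm_powerAlloc_le hα t x).trans ?_
    have := ht.1
    have := ht.2
    gcongr
  · unfold powerAlloc
    fun_prop

lemma tendsto_integral_powerAlloc {α : ℝ} (hα : 0 < α) :
    Filter.Tendsto (fun t => ∫ x, powerAlloc α t x ∂μ) Filter.atTop Filter.atTop := by
  -- after division by `t ^ 2` the integrand is bounded by `α` and tends to `α` pointwise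
  have hlim : Filter.Tendsto (fun t : ℝ => ∫ x, α * max 0 (1 - x ^ 2 / t ^ 2) ∂μ) Filter.atTop
      (nhds (∫ _, α ∂μ)) := by
    refine tendsto_integral_filter_of_dominated_convergence (fun _ => α)
      (.of_forall fun t => Measurable.aestronglyMeasurable (by fun_prop))
      (.of_forall fun t => .of_forall fun x => ?_) (integrable_const _) (.of_forall fun x => ?_)
    · rw [Real.norm_of_nonneg (mul_nonneg hα.le (le_max_left _ _))]
      refine mul_le_of_le_one_right hα.le (max_le zero_le_one ?_)
      linarith [div_nonneg (sq_nonneg x) (sq_nonneg t)]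
    · have h0 : Filter.Tendsto (fun t : ℝ => x ^ 2 / t ^ 2) Filter.atTop (nhds 0) :=
        tendsto_const_nhds.div_atTop (Filter.tendsto_pow_atTop two_ne_zero)
      simpa using (tendsto_const_nhds (x := (0 : ℝ)).max (h0.const_sub 1)).const_mul α
  rw [integral_const, probReal_univ, one_smul] at hlim
  have hsq : Filter.Tendsto (fun t : ℝ => t ^ 2) Filter.atTop Filter.atTop :=
    Filter.tendsto_pow_atTop two_ne_zero
  refine (hlim.pos_mul_atTop hα hsq).congr' ?_
  filter_upwards [Filter.eventually_gt_atTop 0] with t ht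
  rw [← integral_mul_const]
  refine integral_congr_ae (.of_forall fun x => ?_)
  have ht2 : (0 : ℝ) ≤ t ^ 2 := by positivity
  simp only [powerAlloc]
  rw [mul_assoc, max_mul_of_nonneg _ _ ht2, zero_mul, sub_mul, one_mul, div_mul_cancel₀]
  positivity

lemma powerAlloc_mono {α : ℝ} (hα : 0 ≤ α) {s t : ℝ} (hs : 0 ≤ s) (hst : s ≤ t) (x : ℝ) :
    powerAlloc α s x ≤ powerAlloc α t x := by
  unfold powerAlloc
  gcongr

/-- The total power is strictly increasing in the threshold as soon as it is positive. -/
lemma integral_powerAlloc_lt {α : ℝ} (hα : 0 < α) {s t : ℝ} (hs : 0 ≤ s) (hst : s < t)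
    (hpos : 0 < ∫ x, powerAlloc α t x ∂μ) :
    ∫ x, powerAlloc α s x ∂μ < ∫ x, powerAlloc α t x ∂μ := by
  have hmono := powerAlloc_mono hα.le hs hst.le
  have hle : ∫ x, powerAlloc α s x ∂μ ≤ ∫ x, powerAlloc α t x ∂μ :=
    integral_mono (integrable_powerAlloc μ hα.le s) (integrable_powerAlloc μ hα.le t) hmono
  refine hle.lt_of_ne fun heq => hpos.ne' ?_
  -- equality forces `t ^ 2 ≤ x ^ 2` almost everywhere, and then the power vanishes
  have hae := (integral_eq_iff_of_ae_le (integrable_powerAlloc μ hα.le s)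
    (integrable_powerAlloc μ hα.le t) (.of_forall hmono)).1 heq
  refine integral_eq_zero_of_ae ?_
  filter_upwards [hae] with x hx
  have hsq : s ^ 2 < t ^ 2 := by gcongr
  have hx' := mul_left_cancel₀ hα.ne' hx
  have : t ^ 2 - x ^ 2 ≤ 0 := by
    by_contra! hcon
    rw [max_eq_right hcon.le] at hx'
    rcases max_choice 0 (s ^ 2 - x ^ 2) with h | h <;> rw [h] at hx' <;> linarith
  simp [powerAlloc, max_eq_left this]

lemma existsUnique_threshold {α PS : ℝ} (hα : 0 < α) (hPS : 0 < PS) :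
    ∃! t : ℝ, 0 < t ∧ ∫ x, powerAlloc α t x ∂μ = PS := by
  obtain ⟨T, hT, hT0⟩ := ((tendsto_integral_powerAlloc μ hα).eventually_ge_atTop PS).and
    (Filter.eventually_ge_atTop 0) |>.exists
  have h0 : ∫ x, powerAlloc α 0 x ∂μ = 0 := by
    refine integral_eq_zero_of_ae (.of_forall fun x => ?_)
    simp [powerAlloc, sq_nonneg x]
  obtain ⟨t, ht, hFt⟩ := intermediate_value_Icc hT0 (continuousOn_integral_powerAlloc μ hα.le T)
    (show PS ∈ Set.Icc _ _ from ⟨h0.le.trans hPS.le, hT⟩)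
  simp only at hFt
  have ht0 : 0 < t := by
    refine ht.1.lt_of_ne fun h => ?_
    rw [← h, h0] at hFt
    exact hPS.ne hFt
  refine ⟨t, ⟨ht0, hFt⟩, fun s hs => ?_⟩
  rcases lt_trichotomy s t with h | h | h
  · exact absurd (integral_powerAlloc_lt μ hα hs.1.le h (hFt ▸ hPS)) (by simp [hs.2, ← hFt])
  · exact h
  · exact absurd (integral_powerAlloc_lt μ hα ht0.le h (hs.2 ▸ hPS)) (by simp [hs.2, ← hFt])

end Threshold

/-! ### Capacity and marginal value of power at one relay input -/

section WaterFilling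

/-- The variance `σR² + α x²` of the noise seen by the relay when its input is `x`. -/
noncomputable def noiseVar (α σR x : ℝ) : ℝ≥0 := (α * x ^ 2).toNNReal + (σR ^ 2).toNNReal

/-- The variance of the relay output when the relay input is `x` and the source uses the power
`powerAlloc α t x`; it equals `σR² + α max {x², t²}`. -/
noncomputable def outputVar (α σR t x : ℝ) : ℝ≥0 :=
  (powerAlloc α t x).toNNReal + noiseVar α σR x

/-- The slope, in nats per unit of power, of `p ↦ ½ log (1 + p / noiseVar)` at the allocated power:
the common value on the set where the source is active. -/
noncomputable def waterSlope (α σR t : ℝ) : ℝ := 1 / (2 * (σR ^ 2 + α * t ^ 2))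

variable {α σR : ℝ}

lemma measurable_noiseVar (α σR : ℝ) : Measurable (noiseVar α σR) := by
  unfold noiseVar
  fun_prop

lemma measurable_outputVar (α σR t : ℝ) : Measurable (outputVar α σR t) :=
  (measurable_powerAlloc α t).real_toNNReal.add (measurable_noiseVar α σR)

lemma coe_noiseVar (hα : 0 ≤ α) (σR x : ℝ) : (noiseVar α σR x : ℝ) = σR ^ 2 + α * x ^ 2 := by
  rw [noiseVar, NNReal.coe_add, Real.coe_toNNReal _ (by positivity),
    Real.coe_toNNReal _ (by positivity), add_comm]

lemma noiseVar_ne_zero (α : ℝ) (hσ : 0 < σR) (x : ℝ) : noiseVar α σR x ≠ 0 := by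
  have h : 0 < (σR ^ 2).toNNReal := Real.toNNReal_pos.2 (by positivity)
  exact (h.trans_le le_add_self).ne'

lemma noiseVar_le_outputVar (α σR t x : ℝ) : noiseVar α σR x ≤ outputVar α σR t x := le_add_self

lemma outputVar_ne_zero (α : ℝ) (hσ : 0 < σR) (t x : ℝ) : outputVar α σR t x ≠ 0 :=
  ((noiseVar_ne_zero α hσ x).bot_lt.trans_le (noiseVar_le_outputVar α σR t x)).ne'

lemma coe_outputVar (hα : 0 ≤ α) (σR t x : ℝ) :
    (outputVar α σR t x : ℝ) = powerAlloc α t x + (σR ^ 2 + α * x ^ 2) := by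
  rw [outputVar, NNReal.coe_add, coe_noiseVar hα, Real.coe_toNNReal _ (powerAlloc_nonneg hα t x)]

lemma waterSlope_pos (hα : 0 ≤ α) (hσ : 0 < σR) (t : ℝ) : 0 < waterSlope α σR t := by
  unfold waterSlope
  positivity

/-- The marginal value of power is at most `waterSlope` at every relay input. -/
lemma inv_outputVar_le_waterSlope (hα : 0 ≤ α) (hσ : 0 < σR) (t x : ℝ) :
    1 / (2 * (outputVar α σR t x : ℝ)) ≤ waterSlope α σR t := by
  rw [coe_outputVar hα, waterSlope]
  have h : α * (t ^ 2 - x ^ 2) ≤ powerAlloc α t x :=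
    mul_le_mul_of_nonneg_left (le_max_right _ _) hα
  exact one_div_le_one_div_of_le (by positivity) (by linarith)

/-- Complementary slackness: power is spent only where its marginal value is `waterSlope`. -/
lemma powerAlloc_div_outputVar (hα : 0 ≤ α) (σR t x : ℝ) :
    powerAlloc α t x / (2 * outputVar α σR t x) = waterSlope α σR t * powerAlloc α t x := by
  rw [coe_outputVar hα, waterSlope]
  rcases le_total (t ^ 2 - x ^ 2) 0 with h | h
  · simp [powerAlloc, max_eq_left h]
  · have : powerAlloc α t x + (σR ^ 2 + α * x ^ 2) = σR ^ 2 + α * t ^ 2 := by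
      rw [powerAlloc, max_eq_right h]
      ring
    rw [this]
    ring

/-- The capacity, in nats, of the source-relay link at relay input `x` under the power allocation
with threshold `t`. -/
noncomputable def linkCapacity (α σR t x : ℝ) : ℝ :=
  1 / 2 * Real.log (outputVar α σR t x / noiseVar α σR x)

lemma linkCapacity_nonneg (α : ℝ) (hσ : 0 < σR) (t x : ℝ) : 0 ≤ linkCapacity α σR t x := by
  have hv : (0 : ℝ) < noiseVar α σR x := NNReal.coe_pos.2 (noiseVar_ne_zero α hσ x).bot_lt
  refine mul_nonneg (by norm_num) (Real.log_nonneg ((one_le_div hv).2 ?_))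
  exact_mod_cast noiseVar_le_outputVar α σR t x

lemma measurable_linkCapacity (α σR t : ℝ) : Measurable (linkCapacity α σR t) :=
  (((measurable_outputVar α σR t).coe_nnreal_real.div
    (measurable_noiseVar α σR).coe_nnreal_real).log).const_mul _

lemma linkCapacity_eq (hα : 0 ≤ α) (hσ : 0 < σR) (t x : ℝ) :
    linkCapacity α σR t x =
      1 / 2 * Real.log (1 + α * max 0 (t ^ 2 - x ^ 2) / (σR ^ 2 + α * x ^ 2)) := by
  have hv : σR ^ 2 + α * x ^ 2 ≠ 0 := by positivity
  rw [linkCapacity, coe_outputVar hα, coe_noiseVar hα, add_div, div_self hv, add_comm (1 : ℝ),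
    powerAlloc]

lemma linkCapacity_le (hα : 0 ≤ α) (hσ : 0 < σR) (t x : ℝ) :
    linkCapacity α σR t x ≤ α * t ^ 2 / (2 * σR ^ 2) := by
  rw [linkCapacity_eq hα hσ]
  have hp : 0 ≤ α * max 0 (t ^ 2 - x ^ 2) := powerAlloc_nonneg hα t x
  have h1 : α * max 0 (t ^ 2 - x ^ 2) / (σR ^ 2 + α * x ^ 2) ≤ α * t ^ 2 / σR ^ 2 := by
    have := max_zero_sub_sq_le t x
    have : 0 ≤ α * x ^ 2 := by positivity
    gcongr
    linarith
  have h2 := Real.log_le_sub_one_of_pos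
    (x := 1 + α * max 0 (t ^ 2 - x ^ 2) / (σR ^ 2 + α * x ^ 2)) (by positivity)
  have h3 : α * t ^ 2 / (2 * σR ^ 2) = 1 / 2 * (α * t ^ 2 / σR ^ 2) := by field_simp
  linarith

lemma integrable_linkCapacity (hα : 0 ≤ α) (hσ : 0 < σR) (t : ℝ) (μ : Measure ℝ)
    [IsFiniteMeasure μ] : Integrable (linkCapacity α σR t) μ :=
  Integrable.of_bound (measurable_linkCapacity α σR t).aestronglyMeasurable
    (α * t ^ 2 / (2 * σR ^ 2)) (.of_forall fun x => by
      rw [Real.norm_of_nonneg (linkCapacity_nonneg α hσ t x)]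
      exact linkCapacity_le hα hσ t x)

end WaterFilling

/-! ### The link at a fixed relay input -/

section OneInput

variable {α σR : ℝ}

/-- The mutual information of the source-relay link at relay input `x`, in nats. -/
noncomputable def mutualInfoNats (α σR x : ℝ) (ν : Measure ℝ) : ℝ≥0∞ :=
  klDiv (sourceRelayLaw α σR x ν)
    ((sourceRelayLaw α σR x ν).fst.prod (sourceRelayLaw α σR x ν).snd)

/-- The divergence of the relay output law at relay input `x` from the output law which the
Gaussian input of variance `powerAlloc α t x` produces. -/
noncomputable def outputGap (α σR t x : ℝ) (ν : Measure ℝ) : ℝ≥0∞ :=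
  klDiv (ν ∗ gaussianReal 0 (noiseVar α σR x)) (gaussianReal 0 (outputVar α σR t x))

lemma mutualInfoNats_add_outputGap_eq (hα : 0 ≤ α) (hσ : 0 < σR) (t x : ℝ) (ν : Measure ℝ)
    [IsProbabilityMeasure ν] :
    mutualInfoNats α σR x ν + outputGap α σR t x ν +
        ENNReal.ofReal (waterSlope α σR t) * ENNReal.ofReal (powerAlloc α t x) =
      ENNReal.ofReal (linkCapacity α σR t x) +
        ENNReal.ofReal (1 / (2 * outputVar α σR t x)) * ∫⁻ s, ENNReal.ofReal (s ^ 2) ∂ν := by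
  have h := klDiv_awgn_add ν (noiseVar_ne_zero α hσ x) (noiseVar_le_outputVar α σR t x)
  have hgap : (outputVar α σR t x : ℝ) - noiseVar α σR x = powerAlloc α t x := by
    rw [coe_outputVar hα, coe_noiseVar hα, add_sub_cancel_right]
  rw [hgap, powerAlloc_div_outputVar hα, ENNReal.ofReal_mul (waterSlope_pos hα hσ t).le] at h
  rw [mutualInfoNats, sourceRelayLaw_eq_compProd]
  exact h

/-- The identity `mutualInfoNats_add_outputGap_eq` with the marginal value of power replaced by
its upper bound `waterSlope`, which no longer depends on the relay input. -/
lemma mutualInfoNats_add_outputGap_le (hα : 0 ≤ α) (hσ : 0 < σR) (t x : ℝ) (ν : Measure ℝ)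
    [IsProbabilityMeasure ν] :
    mutualInfoNats α σR x ν + outputGap α σR t x ν +
        ENNReal.ofReal (waterSlope α σR t) * ENNReal.ofReal (powerAlloc α t x) ≤
      ENNReal.ofReal (linkCapacity α σR t x) +
        ENNReal.ofReal (waterSlope α σR t) * ∫⁻ s, ENNReal.ofReal (s ^ 2) ∂ν := by
  rw [mutualInfoNats_add_outputGap_eq hα hσ]
  gcongr
  exact inv_outputVar_le_waterSlope hα hσ t x

lemma gaussianReal_conv_noise (α σR t x : ℝ) :
    gaussianReal 0 (powerAlloc α t x).toNNReal ∗ gaussianReal 0 (noiseVar α σR x) =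
      gaussianReal 0 (outputVar α σR t x) := by
  rw [gaussianReal_conv_gaussianReal, add_zero, outputVar]

lemma mutualInfoNats_gaussianReal (hα : 0 ≤ α) (hσ : 0 < σR) (t x : ℝ) :
    mutualInfoNats α σR x (gaussianReal 0 (powerAlloc α t x).toNNReal) =
      ENNReal.ofReal (linkCapacity α σR t x) := by
  have h := mutualInfoNats_add_outputGap_eq hα hσ t x (gaussianReal 0 (powerAlloc α t x).toNNReal)
  rw [outputGap, gaussianReal_conv_noise, klDiv_self, add_zero, lintegral_sq_gaussianReal] at h
  change _ = _ + _ * ENNReal.ofReal (powerAlloc α t x) at h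
  rw [← ENNReal.ofReal_mul (waterSlope_pos hα hσ t).le, ← ENNReal.ofReal_mul (by positivity),
    one_div_mul_eq_div, powerAlloc_div_outputVar hα] at h
  exact (ENNReal.add_left_inj ENNReal.ofReal_ne_top).1 h

lemma eq_gaussianReal_of_outputGap_eq_zero (α σR t x : ℝ) (ν : Measure ℝ) [IsProbabilityMeasure ν]
    (h : outputGap α σR t x ν = 0) : ν = gaussianReal 0 (powerAlloc α t x).toNNReal := by
  refine conv_gaussianReal_right_injective 0 (noiseVar α σR x) ?_
  rw [gaussianReal_conv_noise]
  exact klDiv_eq_zero_iff.1 h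

end OneInput

/-! ### Averaging over the relay input -/

section Averaged

variable {α σR : ℝ}

lemma measurable_outputGap (hσ : 0 < σR) (t : ℝ) (κ : Kernel ℝ ℝ) [IsMarkovKernel κ] :
    Measurable fun x => outputGap α σR t x (κ x) := by
  let N : Kernel ℝ ℝ := ⟨fun x => gaussianReal 0 (noiseVar α σR x),
    measurable_gaussianReal.comp (measurable_const.prodMk (measurable_noiseVar α σR))⟩
  let G : Kernel ℝ ℝ := ⟨fun x => gaussianReal 0 (outputVar α σR t x),
    measurable_gaussianReal.comp (measurable_const.prodMk (measurable_outputVar α σR t))⟩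
  have hN : IsMarkovKernel N := ⟨fun x => instIsProbabilityMeasureGaussianReal _ _⟩
  have hG : IsMarkovKernel G := ⟨fun x => instIsProbabilityMeasureGaussianReal _ _⟩
  let Q : Kernel ℝ ℝ := (κ ×ₖ N).map fun p => p.1 + p.2
  have hQ : IsMarkovKernel Q := Kernel.IsMarkovKernel.map _ (by fun_prop)
  have hQx : ∀ x, Q x = κ x ∗ gaussianReal 0 (noiseVar α σR x) := fun x => by
    rw [Kernel.map_apply _ (by fun_prop), Kernel.prod_apply]
    rfl
  have hmeas := measurable_klDiv_kernel Q G fun x => by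
    rw [hQx]
    exact (Measure.conv_absolutelyContinuous
      (gaussianReal_absolutelyContinuous 0 (noiseVar_ne_zero α hσ x))).trans
      (gaussianReal_absolutelyContinuous' 0 (outputVar_ne_zero α hσ t x))
  simp only [hQx] at hmeas
  exact hmeas

variable {PS t : ℝ} {μ : Measure ℝ} [IsProbabilityMeasure μ]

lemma lintegral_powerAlloc (hα : 0 ≤ α) (ht : ∫ x, powerAlloc α t x ∂μ = PS) :
    ∫⁻ x, ENNReal.ofReal (powerAlloc α t x) ∂μ = ENNReal.ofReal PS := by
  rw [← ht, ofReal_integral_eq_lintegral_ofReal (integrable_powerAlloc μ hα t)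
    (.of_forall (powerAlloc_nonneg hα t))]

lemma gaussianSource_mem_admissible (hα : 0 ≤ α) (ht : ∫ x, powerAlloc α t x ∂μ = PS) :
    gaussianSource α t ∈ admissible μ PS := by
  refine ⟨⟨fun x => instIsProbabilityMeasureGaussianReal _ _⟩, ?_⟩
  rw [← lintegral_powerAlloc hα ht]
  exact (lintegral_congr fun x => lintegral_sq_gaussianReal _).le

/-- Weak duality: with `waterSlope` as the multiplier of the power constraint, averaging the
bound at each relay input leaves only the capacities. -/
lemma lintegral_mutualInfoNats_add_outputGap_le (hα : 0 ≤ α) (hσ : 0 < σR)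
    (ht : ∫ x, powerAlloc α t x ∂μ = PS) {κ : Kernel ℝ ℝ} (hκ : κ ∈ admissible μ PS) :
    ∫⁻ x, mutualInfoNats α σR x (κ x) ∂μ + ∫⁻ x, outputGap α σR t x (κ x) ∂μ ≤
      ∫⁻ x, ENNReal.ofReal (linkCapacity α σR t x) ∂μ := by
  have := hκ.1
  have hfin : ENNReal.ofReal (waterSlope α σR t) * ENNReal.ofReal PS ≠ ∞ := by finiteness
  refine (ENNReal.add_le_add_iff_right hfin).1 ?_
  calc _ = ∫⁻ x, mutualInfoNats α σR x (κ x) ∂μ + ∫⁻ x, outputGap α σR t x (κ x) ∂μ +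
          ∫⁻ x, ENNReal.ofReal (waterSlope α σR t) * ENNReal.ofReal (powerAlloc α t x) ∂μ := by
        rw [lintegral_const_mul' _ _ ENNReal.ofReal_ne_top, lintegral_powerAlloc hα ht]
    -- superadditivity of the lower integral makes measurability of the first summand superfluous
    _ ≤ ∫⁻ x, (mutualInfoNats α σR x (κ x) + outputGap α σR t x (κ x) +
          ENNReal.ofReal (waterSlope α σR t) * ENNReal.ofReal (powerAlloc α t x)) ∂μ :=
        (add_le_add_left (le_lintegral_add _ _) _).trans (le_lintegral_add _ _)
    _ ≤ ∫⁻ x, (ENNReal.ofReal (linkCapacity α σR t x) +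
          ENNReal.ofReal (waterSlope α σR t) * ∫⁻ s, ENNReal.ofReal (s ^ 2) ∂(κ x)) ∂μ :=
        lintegral_mono fun x => mutualInfoNats_add_outputGap_le hα hσ t x (κ x)
    _ = ∫⁻ x, ENNReal.ofReal (linkCapacity α σR t x) ∂μ +
          ENNReal.ofReal (waterSlope α σR t) * sourcePower μ κ := by
        rw [lintegral_add_left (measurable_linkCapacity α σR t).ennreal_ofReal,
          lintegral_const_mul' _ _ ENNReal.ofReal_ne_top, sourcePower]
    _ ≤ _ := by
        gcongr
        exact hκ.2

lemma condMutualInfo_eq_div (α σR : ℝ) (μ : Measure ℝ) (κ : Kernel ℝ ℝ) :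
    condMutualInfo α σR μ κ =
      (∫⁻ x, mutualInfoNats α σR x (κ x) ∂μ) / ENNReal.ofReal (Real.log 2) := by
  have hlog : 0 < Real.log 2 := Real.log_pos one_lt_two
  rw [div_eq_mul_inv, ← lintegral_mul_const' _ _ (ENNReal.inv_ne_top.2 (by simpa using hlog))]
  rfl

lemma condMutualInfo_gaussianSource (hα : 0 ≤ α) (hσ : 0 < σR) (t : ℝ) (μ : Measure ℝ) :
    condMutualInfo α σR μ (gaussianSource α t) =
      (∫⁻ x, ENNReal.ofReal (linkCapacity α σR t x) ∂μ) / ENNReal.ofReal (Real.log 2) := by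
  rw [condMutualInfo_eq_div]
  congr 1
  exact lintegral_congr fun x => mutualInfoNats_gaussianReal hα hσ t x

lemma isMaxOn_gaussianSource (hα : 0 ≤ α) (hσ : 0 < σR) (ht : ∫ x, powerAlloc α t x ∂μ = PS) :
    IsMaxOn (condMutualInfo α σR μ) (admissible μ PS) (gaussianSource α t) := by
  intro κ hκ
  rw [Set.mem_ofPred_eq, condMutualInfo_gaussianSource hα hσ, condMutualInfo_eq_div]
  refine ENNReal.div_le_div_right ?_ _
  exact le_self_add.trans (lintegral_mutualInfoNats_add_outputGap_le hα hσ ht hκ)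

lemma lintegral_linkCapacity (hα : 0 ≤ α) (hσ : 0 < σR) (t : ℝ) (μ : Measure ℝ)
    [IsProbabilityMeasure μ] :
    ∫⁻ x, ENNReal.ofReal (linkCapacity α σR t x) ∂μ =
      ENNReal.ofReal (∫ x, linkCapacity α σR t x ∂μ) :=
  (ofReal_integral_eq_lintegral_ofReal (integrable_linkCapacity hα hσ t μ)
    (.of_forall (linkCapacity_nonneg α hσ t))).symm

lemma ae_eq_gaussianSource_of_isMaxOn (hα : 0 ≤ α) (hσ : 0 < σR)
    (ht : ∫ x, powerAlloc α t x ∂μ = PS) {κ : Kernel ℝ ℝ} (hκ : κ ∈ admissible μ PS)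
    (hmax : IsMaxOn (condMutualInfo α σR μ) (admissible μ PS) κ) :
    ∀ᵐ x ∂μ, κ x = gaussianSource α t x := by
  have := hκ.1
  have hlog : 0 < Real.log 2 := Real.log_pos one_lt_two
  have hle : condMutualInfo α σR μ (gaussianSource α t) ≤ condMutualInfo α σR μ κ :=
    hmax (gaussianSource_mem_admissible hα ht)
  rw [condMutualInfo_gaussianSource hα hσ, condMutualInfo_eq_div,
    ENNReal.div_le_iff (by simpa using hlog) ENNReal.ofReal_ne_top,
    ENNReal.div_mul_cancel (by simpa using hlog) ENNReal.ofReal_ne_top] at hle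
  have hgap : ∫⁻ x, outputGap α σR t x (κ x) ∂μ = 0 := by
    have h := lintegral_mutualInfoNats_add_outputGap_le hα hσ ht hκ
    rw [lintegral_linkCapacity hα hσ] at h hle
    have h' := ((add_le_add_left hle _).trans h).trans_eq (add_zero _).symm
    -- the maximum is finite, so it can be cancelled
    simpa using (ENNReal.add_le_add_iff_left ENNReal.ofReal_ne_top).1 h'
  filter_upwards [(lintegral_eq_zero_iff (measurable_outputGap hσ t κ)).1 hgap] with x hx
  exact eq_gaussianReal_of_outputGap_eq_zero α σR t x (κ x) hx

end Averaged

end RelayChannel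

theorem theorem1 (α σR PS : ℝ) (hα : 0 < α) (hσ : 0 < σR) (hPS : 0 < PS)
    (μ : Measure ℝ) [IsProbabilityMeasure μ] :
    (∃! t : ℝ, 0 < t ∧ ∫ x, α * max 0 (t ^ 2 - x ^ 2) ∂μ = PS) ∧
    ∀ t : ℝ, 0 < t → ∫ x, α * max 0 (t ^ 2 - x ^ 2) ∂μ = PS →
      RelayChannel.gaussianSource α t ∈ RelayChannel.admissible μ PS ∧
      IsMaxOn (RelayChannel.condMutualInfo α σR μ) (RelayChannel.admissible μ PS)
        (RelayChannel.gaussianSource α t) ∧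
      (∀ κ ∈ RelayChannel.admissible μ PS,
        IsMaxOn (RelayChannel.condMutualInfo α σR μ) (RelayChannel.admissible μ PS) κ →
          ∀ᵐ x ∂μ, κ x = RelayChannel.gaussianSource α t x) ∧
      Integrable (fun x => 1 / 2 * Real.logb 2
        (1 + α * max 0 (t ^ 2 - x ^ 2) / (σR ^ 2 + α * x ^ 2))) μ ∧
      RelayChannel.condMutualInfo α σR μ (RelayChannel.gaussianSource α t) =
        ENNReal.ofReal (∫ x, 1 / 2 * Real.logb 2
          (1 + α * max 0 (t ^ 2 - x ^ 2) / (σR ^ 2 + α * x ^ 2)) ∂μ) := by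
  refine ⟨RelayChannel.existsUnique_threshold μ hα hPS, fun t _ ht => ?_⟩
  have hbits : (fun x => 1 / 2 * Real.logb 2
      (1 + α * max 0 (t ^ 2 - x ^ 2) / (σR ^ 2 + α * x ^ 2))) =
      fun x => RelayChannel.linkCapacity α σR t x / Real.log 2 := by
    funext x
    rw [RelayChannel.linkCapacity_eq hα.le hσ, Real.logb, ← mul_div_assoc]
  have hlog : 0 < Real.log 2 := Real.log_pos one_lt_two
  refine ⟨RelayChannel.gaussianSource_mem_admissible hα.le ht,
    RelayChannel.isMaxOn_gaussianSource hα.le hσ ht,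
    fun κ hκ hmax => RelayChannel.ae_eq_gaussianSource_of_isMaxOn hα.le hσ ht hκ hmax, ?_, ?_⟩
  · rw [hbits]
    exact (RelayChannel.integrable_linkCapacity hα.le hσ t μ).div_const _
  · rw [hbits, integral_div, RelayChannel.condMutualInfo_gaussianSource hα.le hσ,
      RelayChannel.lintegral_linkCapacity hα.le hσ, ENNReal.ofReal_div_of_pos hlog]
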